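/- Let $\tau=\frac{1+\sqrt5}{2}$, let $\Gamma\subset\mathbb{R}\times\mathbb{R}$ be the lattice spanned over $\mathbb{Z}$ by $(1,1)$ and $(\tau,-\frac1\tau)$, and let $\pi_1,\pi_2$ be the projections of $\mathbb{R}\times\mathbb{R}$ to the first and to the second coordinate. Put $$W_1=\Big[-\tfrac1\tau,\tfrac{1-1/\tau}{2}\Big[,\qquad W_2=\Big[\tfrac{1-1/\tau}{2},1\Big[,\qquad F_i=\{\pi_1(x) : x\in\Gamma,\ \pi_2(x)\in W_i\}\quad(i=1,2).$$ Definitions. Data $(\Gamma,W)$ define a cut-and-project set $\{\pi_1(x): x\in\Gamma,\ \pi_2(x)\in W\}$ if $\Gamma$ is a lattice (a discrete subgroup that spans the whole space over $\mathbb{R}$), $W$ is relatively compact, $\pi_1|_\Gamma$ is one-to-one and $\pi_2(\Gamma)$ is dense in $W$. Two sets $\Lambda,\Lambda'\subset\mathbb{R}$ are bounded distance equivalent if there are $c>0$ and a bijection $\phi:\Lambda\to\Lambda'$ with $|x-\phi(x)|<c$ for all $x\in\Lambda$. Two sets $\Lambda,\Lambda'\subset\mathbb{R}$ are $\varepsilon$-close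 if $\Lambda\cap{]-\frac1\varepsilon,\frac1\varepsilon[}=(t+\Lambda')\cap{]-\frac1\varepsilon,\frac1\varepsilon[}$ for some $t$ with $|t|<\varepsilon$. In the local topology, a family of subsets of $\mathbb{R}$ is open if with each member $\Lambda$ it contains, for some $\varepsilon>0$, all sets that are $\varepsilon$-close to $\Lambda$. The hull of $\Lambda$ is the closure of $\{t+\Lambda : t\in\mathbb{R}\}$ in the local topology. Theorem. Both $(\Gamma,W_1)$ and $(\Gamma,W_2)$ define cut-and-project sets (namely $F_1$ and $F_2$). The windows $W_1$ and $W_2$ are disjoint, have union $[-\frac1\tau,1[$, and have equal length. The sets $F_1$ and $F_2$ have the same hull, and $F_1$ and $F_2$ are not bounded distance equivalent. In particular, two cut-and-project sets in the same hull need not be bounded distance equivalent. -/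

import Mathlib

/-- Two point sets `A`, `B` in a metric space are bounded distance equivalent if there are
`c > 0` and a bijection `f : A → B` that moves every point by less than `c`. -/
def BoundedDistEquiv {X : Type*} [MetricSpace X] (A B : Set X) : Prop :=
  ∃ c : ℝ, 0 < c ∧ ∃ f : A ≃ B, ∀ x : A, dist (x : X) (f x : X) < c

/-- `Γ` and `W` are admissible data of a cut-and-project set with physical space `ℝ` and internal
space `H`, where the two projections are `Prod.fst` and `Prod.snd`: `Γ` is a (full rank) lattice in
`ℝ × H`, the window `W` is relatively compact, the first projection is one-to-one on `Γ`, and the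
second projection of `Γ` is dense in `W`. -/
structure IsCutAndProjectData {H : Type*} [NormedAddCommGroup H] [NormedSpace ℝ H]
    (Γ : Submodule ℤ (ℝ × H)) (W : Set H) : Prop where
  discrete : DiscreteTopology Γ
  span_top : Submodule.span ℝ (Γ : Set (ℝ × H)) = ⊤
  relatively_compact : IsCompact (closure W)
  injOn_fst : Set.InjOn Prod.fst (Γ : Set (ℝ × H))
  dense_snd : W ⊆ closure (Prod.snd '' (Γ : Set (ℝ × H)))

/-- The set of all `π₁ x` with `x ∈ Γ` and `π₂ x ∈ W`. -/
def cutAndProject {H : Type*} [NormedAddCommGroup H] [NormedSpace ℝ H]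
    (Γ : Submodule ℤ (ℝ × H)) (W : Set H) : Set ℝ :=
  {p | ∃ x ∈ Γ, x.2 ∈ W ∧ x.1 = p}

/-- The translate `t + A` of a point set on the line. -/
def translateSet (t : ℝ) (A : Set ℝ) : Set ℝ := (fun x => t + x) '' A

/-- `A` and `B` are `ε`-close: after a translation of `B` by less than `ε` they agree on the
open interval of radius `1 / ε` about the origin. -/
def LocallyClose (ε : ℝ) (A B : Set ℝ) : Prop :=
  ∃ t : ℝ, |t| < ε ∧
    A ∩ Metric.ball 0 (1 / ε) = translateSet t B ∩ Metric.ball 0 (1 / ε)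

theorem LocallyClose.mono {ε δ : ℝ} (hε : 0 < ε) (h : ε ≤ δ) {A B : Set ℝ}
    (hAB : LocallyClose ε A B) : LocallyClose δ A B := by
  obtain ⟨t, ht, hE⟩ := hAB
  refine ⟨t, ht.trans_le h, ?_⟩
  have hsub : Metric.ball (0 : ℝ) (1 / δ) ⊆ Metric.ball 0 (1 / ε) :=
    Metric.ball_subset_ball (one_div_le_one_div_of_le hε h)
  ext x
  constructor
  · rintro ⟨hx, hb⟩
    have : x ∈ translateSet t B ∩ Metric.ball 0 (1 / ε) := hE ▸ ⟨hx, hsub hb⟩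
    exact ⟨this.1, hb⟩
  · rintro ⟨hx, hb⟩
    have : x ∈ A ∩ Metric.ball 0 (1 / ε) := hE ▸ ⟨hx, hsub hb⟩
    exact ⟨this.1, hb⟩

/-- The local topology on point sets of the line: a collection of point sets is open if with each
member `A` it contains, for some `ε > 0`, all point sets that are `ε`-close to `A`. -/
@[reducible]
def localTopology : TopologicalSpace (Set ℝ) where
  IsOpen U := ∀ A ∈ U, ∃ ε : ℝ, 0 < ε ∧ ∀ B : Set ℝ, LocallyClose ε A B → B ∈ U
  isOpen_univ := fun _ _ => ⟨1, one_pos, fun _ _ => trivial⟩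
  isOpen_inter := by
    rintro U V hU hV A ⟨hAU, hAV⟩
    obtain ⟨ε, hε, h1⟩ := hU A hAU
    obtain ⟨δ, hδ, h2⟩ := hV A hAV
    have hm : 0 < min ε δ := lt_min hε hδ
    exact ⟨min ε δ, hm, fun B hB =>
      ⟨h1 B (hB.mono hm (min_le_left _ _)), h2 B (hB.mono hm (min_le_right _ _))⟩⟩
  isOpen_sUnion := by
    rintro S hS A ⟨U, hU, hA⟩
    obtain ⟨ε, hε, h⟩ := hS U hU A hA
    exact ⟨ε, hε, fun B hB => ⟨U, hU, h B hB⟩⟩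

/-- The hull of a point set on the line: the closure, in the local topology, of the set of all
its translates. -/
def hull (A : Set ℝ) : Set (Set ℝ) :=
  @closure _ localTopology (Set.range fun t : ℝ => translateSet t A)

/-- The Fibonacci lattice, spanned over `ℤ` by `(1, 1)` and `(τ, -1/τ)`, where `τ = (1 + √5)/2` is
the golden ratio. -/
noncomputable def fibLattice : Submodule ℤ (ℝ × ℝ) :=
  Submodule.span ℤ {((1 : ℝ), (1 : ℝ)), (Real.goldenRatio, -(1 / Real.goldenRatio))}

/-- The window `[-1/τ, 1[` of the Fibonacci sequence. -/
noncomputable def fibWindow : Set ℝ := Set.Ico (-(1 / Real.goldenRatio)) 1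

/-- The left half of the Fibonacci window. -/
noncomputable def halfFibWindow₁ : Set ℝ :=
  Set.Ico (-(1 / Real.goldenRatio)) ((1 - 1 / Real.goldenRatio) / 2)

/-- The right half of the Fibonacci window. -/
noncomputable def halfFibWindow₂ : Set ℝ :=
  Set.Ico ((1 - 1 / Real.goldenRatio) / 2) 1

/-- The first half-Fibonacci sequence. -/
noncomputable def halfFib₁ : Set ℝ := cutAndProject fibLattice halfFibWindow₁

/-- The second half-Fibonacci sequence. -/
noncomputable def halfFib₂ : Set ℝ := cutAndProject fibLattice halfFibWindow₂

open Filter MeasureTheory Function Topology Real goldenRatio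

/-! The right half-window is the left one shifted by `φ / 2`. The lattice projects densely to
internal space, so the shift is approximated by lattice vectors, and every bounded patch of one set
occurs exactly in a translate of the other. This gives equal hulls
(`hull_cutAndProject_Ico_subset`).

For the negative part, the full window has length `φ`, hence is a fundamental domain of `ℝ/φℤ`. The
Fibonacci point `m + nφ` gets the index `k = m + n`, and its internal coordinate is the
representative of `k` modulo `φ`. So the half containing it is read off the orbit of the rotation
`T` by `1`. Indices differ by at most the distance of the points, so a bounded distance bijection
would keep the numbers of indices of the two kinds in any interval within a fixed bound of each
other. The differences of these numbers are the Birkhoff sums of `halfSign` at integers; by density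
the bound extends to almost every starting point.

The upper limit `S` of the sums would then be a finite integer almost everywhere with `S ∘ T = S -
halfSign`. As `halfSign` is odd, `T` swaps the sets of even and odd `S`. These have equal measure
and are invariant under `T ∘ T`, which is ergodic since `2 / φ` is irrational: a contradiction
(`not_ae_bounded_birkhoffSum_of_odd`). -/

/-! ### The Fibonacci lattice -/

theorem one_div_goldenRatio : 1 / φ = φ - 1 := by
  rw [one_div, inv_goldenRatio, ← one_sub_goldenConj]; linarith [goldenRatio_add_goldenConj]

/-- A real basis of the plane whose integral span is the Fibonacci lattice. -/
noncomputable def fibBasis : Module.Basis (Fin 2) ℝ (ℝ × ℝ) :=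
  basisOfLinearIndependentOfCardEqFinrank
    (b := ![((1 : ℝ), (1 : ℝ)), (φ, -(1 / φ))])
    (by
      rw [LinearIndependent.pair_iff]
      intro s t h
      rw [one_div_goldenRatio] at h
      simp only [Prod.smul_mk, smul_eq_mul, Prod.mk_add_mk, Prod.mk_eq_zero] at h
      have ht : t * (2 * φ - 1) = 0 := by linear_combination h.1 - h.2
      have ht0 : t = 0 := by
        rcases mul_eq_zero.1 ht with h0 | h0
        · exact h0
        · linarith [one_lt_goldenRatio]
      refine ⟨?_, ht0⟩
      simpa [ht0] using h.1)
    (by simp)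

theorem fibLattice_eq_span_range : fibLattice = Submodule.span ℤ (Set.range fibBasis) := by
  simp [fibLattice, fibBasis, Matrix.range_cons, Matrix.range_empty, Set.pair_comm]

theorem mem_fibLattice {x : ℝ × ℝ} :
    x ∈ fibLattice ↔ ∃ m n : ℤ, x.1 = m + n * φ ∧ x.2 = m + n * (1 - φ) := by
  rw [fibLattice, Submodule.mem_span_pair]
  refine exists_congr fun m => exists_congr fun n => ?_
  rw [Prod.ext_iff, one_div_goldenRatio]
  simp [eq_comm]

theorem injOn_fst_fibLattice : Set.InjOn Prod.fst (fibLattice : Set (ℝ × ℝ)) := by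
  intro x hx y hy hxy
  obtain ⟨m, n, h1, h2⟩ := mem_fibLattice.1 hx
  obtain ⟨m', n', h1', h2'⟩ := mem_fibLattice.1 hy
  have key : ((n - n' : ℤ) : ℝ) * φ = ((m' - m : ℤ) : ℝ) := by
    push_cast; linear_combination hxy - h1 + h1'
  have hn : n - n' = 0 := by
    by_contra hne
    exact (goldenRatio_irrational.intCast_mul hne).ne_int _ key
  have hn' : n = n' := by lia
  subst hn'
  refine Prod.ext hxy ?_
  rw [h2, h2']
  have : (m : ℝ) = m' := by linear_combination hxy - h1 + h1'
  rw [this]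

theorem dense_snd_fibLattice : Dense (Prod.snd '' (fibLattice : Set (ℝ × ℝ))) := by
  have hd : Dense (AddSubgroup.closure {(1 : ℝ), 1 - φ} : Set ℝ) := by
    have h := (dense_addSubgroupClosure_pair_iff (a := 1 - φ) (b := 1)).2 (by
      simpa using goldenRatio_irrational.intCast_sub 1)
    rwa [Set.pair_comm] at h
  refine hd.mono fun y hy => ?_
  obtain ⟨m, n, h⟩ := AddSubgroup.mem_closure_pair.1 hy
  refine ⟨(m + n * φ, m + n * (1 - φ)), mem_fibLattice.2 ⟨m, n, rfl, rfl⟩, ?_⟩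
  simpa using h

theorem isCutAndProjectData_fibLattice {W : Set ℝ} (hW : Bornology.IsBounded W) :
    IsCutAndProjectData fibLattice W where
  discrete := by rw [fibLattice_eq_span_range]; infer_instance
  span_top := by rw [fibLattice_eq_span_range]; simp [Submodule.span_span_of_tower]
  relatively_compact := hW.isCompact_closure
  injOn_fst := injOn_fst_fibLattice
  dense_snd := fun x _ => dense_snd_fibLattice x

/-! ### Equality of the hulls -/

/-- A bounded box contains only finitely many lattice points, so their internal coordinates below
`a` cannot accumulate at `a`. -/
theorem exists_forall_fibLattice_notMem_Ico (R a : ℝ) :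
    ∃ δ > 0, ∀ x ∈ fibLattice, |x.1| < R → x.2 < a → x.2 + δ ≤ a := by
  have hfin : (Prod.snd '' ((Metric.ball (0 : ℝ) R ×ˢ Metric.ball a 1) ∩
      (fibLattice : Set (ℝ × ℝ)))).Finite := by
    rw [fibLattice_eq_span_range]
    exact (ZSpan.setFinite_inter fibBasis (Metric.isBounded_ball.prod Metric.isBounded_ball)).image _
  have hfin' := hfin.subset (Set.inter_subset_left (t := Set.Iio a))
  obtain ⟨δ, hδ, hb⟩ := Metric.mem_nhds_iff.1 (hfin'.isClosed.isOpen_compl.mem_nhds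
    (show a ∈ _ from fun h => lt_irrefl a h.2))
  refine ⟨min δ 1, by positivity, fun x hx hR ha => ?_⟩
  by_contra! hlt
  have h1 : |x.2 - a| < min δ 1 := by rw [abs_lt]; constructor <;> linarith [lt_min hδ one_pos]
  refine hb (a := x.2) (by simpa [Real.dist_eq] using h1.trans_le (min_le_left _ _))
    ⟨⟨x, ⟨?_, hx⟩, rfl⟩, ha⟩
  simpa [Real.dist_eq] using ⟨hR, h1.trans_le (min_le_right _ _)⟩

theorem hull_cutAndProject_Ico_subset (a b d : ℝ) :
    hull (cutAndProject fibLattice (Set.Ico a b)) ⊆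
      hull (cutAndProject fibLattice (Set.Ico (a + d) (b + d))) := by
  let _ := localTopology
  refine closure_minimal ?_ isClosed_closure
  rintro _ ⟨t, rfl⟩
  refine mem_closure_iff.2 fun U hU hmem => ?_
  obtain ⟨ε, hε, hεU⟩ := hU _ hmem
  obtain ⟨δ₁, hδ₁, h₁⟩ := exists_forall_fibLattice_notMem_Ico (1 / ε + |t|) a
  obtain ⟨δ₂, hδ₂, h₂⟩ := exists_forall_fibLattice_notMem_Ico (1 / ε + |t|) b
  -- The internal shift exceeds `d` slightly: the windows are closed on the left and open on the
  -- right, so a small excess to the right changes no membership within the patch.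
  obtain ⟨_, ⟨hg1, hg2⟩, g, hg, rfl⟩ := dense_snd_fibLattice.inter_open_nonempty
    (Set.Ioo d (d + min δ₁ δ₂)) isOpen_Ioo (Set.nonempty_Ioo.2 (by linarith [lt_min hδ₁ hδ₂]))
  have hm₁ := min_le_left δ₁ δ₂
  have hm₂ := min_le_right δ₁ δ₂
  have key : ∀ x ∈ fibLattice, |t + x.1| < 1 / ε →
      (x.2 ∈ Set.Ico a b ↔ (x + g).2 ∈ Set.Ico (a + d) (b + d)) := by
    intro x hx hR
    have hR' : |x.1| < 1 / ε + |t| := by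
      have := abs_sub (t + x.1) t
      rw [add_sub_cancel_left] at this; linarith
    simp only [Set.mem_Ico, Prod.snd_add]
    constructor
    · rintro ⟨h3, h4⟩
      constructor
      · linarith
      · linarith [h₂ x hx hR' h4]
    · rintro ⟨h3, h4⟩
      constructor
      · by_contra! h5
        linarith [h₁ x hx hR' h5]
      · linarith
  refine ⟨_, hεU (translateSet (t - g.1) (cutAndProject fibLattice (Set.Ico (a + d) (b + d))))
    ⟨0, by simpa using hε, ?_⟩, ⟨_, rfl⟩⟩
  ext p
  simp only [Set.mem_inter_iff, mem_ball_zero_iff, Real.norm_eq_abs]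
  refine and_congr_left fun hp => ⟨?_, ?_⟩
  · rintro ⟨_, ⟨x, hx, hxW, rfl⟩, rfl⟩
    refine ⟨_, ⟨_, ⟨x + g, add_mem hx hg, (key x hx hp).1 hxW, rfl⟩, rfl⟩, ?_⟩
    simp
  · rintro ⟨_, ⟨_, ⟨y, hy, hyW, rfl⟩, rfl⟩, rfl⟩
    have e : 0 + (t - g.1 + y.1) = t + (y - g).1 := by simp; ring
    dsimp only at hp ⊢
    rw [e] at hp ⊢
    exact ⟨_, ⟨y - g, sub_mem hy hg, (key _ (sub_mem hy hg) hp).2 (by simpa using hyW), rfl⟩, rfl⟩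

theorem hull_halfFib_eq : hull halfFib₁ = hull halfFib₂ := by
  have hφ := one_div_goldenRatio
  refine Set.Subset.antisymm ?_ ?_
  -- The shift `φ / 2` is the common length of the half-windows.
  · have h := hull_cutAndProject_Ico_subset (-(1 / φ)) ((1 - 1 / φ) / 2) (φ / 2)
    rwa [show -(1 / φ) + φ / 2 = (1 - 1 / φ) / 2 by rw [hφ]; ring,
      show (1 - 1 / φ) / 2 + φ / 2 = 1 by rw [hφ]; ring] at h
  · have h := hull_cutAndProject_Ico_subset ((1 - 1 / φ) / 2) 1 (-(φ / 2))
    rwa [show (1 - 1 / φ) / 2 + -(φ / 2) = -(1 / φ) by rw [hφ]; ring,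
      show 1 + -(φ / 2) = (1 - 1 / φ) / 2 by rw [hφ]; ring] at h

/-! ### The two half-windows -/

theorem neg_one_div_goldenRatio_lt : -(1 / φ) < (1 - 1 / φ) / 2 := by
  rw [one_div_goldenRatio]; linarith [one_lt_goldenRatio]

theorem halfFibWindow_lt_one : (1 - 1 / φ) / 2 < 1 := by
  rw [one_div_goldenRatio]; linarith [one_lt_goldenRatio]

theorem volume_halfFibWindow :
    MeasureTheory.volume halfFibWindow₁ = MeasureTheory.volume halfFibWindow₂ := by
  rw [halfFibWindow₁, halfFibWindow₂, Real.volume_Ico, Real.volume_Ico]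
  congr 1; ring

theorem disjoint_halfFibWindow : Disjoint halfFibWindow₁ halfFibWindow₂ :=
  Set.Ico_disjoint_Ico_same

theorem halfFibWindow_union : halfFibWindow₁ ∪ halfFibWindow₂ = fibWindow :=
  Set.Ico_union_Ico_eq_Ico neg_one_div_goldenRatio_lt.le halfFibWindow_lt_one.le

/-! ### Upper limits of integer-valued Birkhoff sums -/

theorem exists_frequently_eq_eventually_le {s : ℕ → ℤ} {B : ℤ} (hs : ∀ n, |s n| ≤ B) :
    ∃ v, (∃ᶠ n in atTop, s n = v) ∧ ∀ᶠ n in atTop, s n ≤ v := by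
  obtain ⟨v, hv, hmax⟩ := Int.exists_greatest_of_bdd (P := fun v => ∃ᶠ n in atTop, v ≤ s n)
    ⟨B, fun v hv => by
      obtain ⟨n, hn⟩ := hv.exists
      exact hn.trans (abs_le.1 (hs n)).2⟩
    ⟨-B, Frequently.of_forall fun n => (abs_le.1 (hs n)).1⟩
  have hle : ∀ᶠ n in atTop, s n ≤ v := by
    have h : ¬ ∃ᶠ n in atTop, v + 1 ≤ s n := fun h => by linarith [hmax _ h]
    filter_upwards [not_frequently.1 h] with n hn using by lia
  exact ⟨v, (hv.and_eventually hle).mono fun n hn => le_antisymm hn.2 hn.1, hle⟩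

/-- The set where `v` is the largest value that the Birkhoff sums take infinitely often, and only
finitely many of them exceed `v`. -/
def birkhoffLimsupSet {α : Type*} (T : α → α) (f : α → ℤ) (v : ℤ) : Set α :=
  {x | (∃ᶠ n in atTop, birkhoffSum T f n x = v) ∧ ∀ᶠ n in atTop, birkhoffSum T f n x ≤ v}

section
variable {α : Type*} {T : α → α} {f : α → ℤ}

theorem eq_of_mem_birkhoffLimsupSet {v w : ℤ} {x : α} (hv : x ∈ birkhoffLimsupSet T f v)
    (hw : x ∈ birkhoffLimsupSet T f w) : v = w := by
  obtain ⟨n, hn, hn'⟩ := (hv.1.and_eventually hw.2).exists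
  obtain ⟨m, hm, hm'⟩ := (hw.1.and_eventually hv.2).exists
  lia

/-- Starting the orbit at `T x` drops the first term `f x` from every sum, so the upper limit
decreases by `f x`. -/
theorem apply_mem_birkhoffLimsupSet_iff {v : ℤ} {x : α} :
    T x ∈ birkhoffLimsupSet T f v ↔ x ∈ birkhoffLimsupSet T f (v + f x) := by
  have hs : ∀ n, birkhoffSum T f (n + 1) x = f x + birkhoffSum T f n (T x) :=
    fun n => birkhoffSum_succ' T f n x
  unfold birkhoffLimsupSet
  simp only [Set.mem_ofPred_eq]
  conv_rhs => rw [← map_add_atTop_eq_nat 1]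
  simp only [frequently_map, eventually_map, hs]
  refine and_congr ⟨fun h => h.mono fun n hn => by lia, fun h => h.mono fun n hn => by lia⟩
    ⟨fun h => h.mono fun n hn => by lia, fun h => h.mono fun n hn => by lia⟩

variable [MeasurableSpace α]

theorem measurable_birkhoffSum_int (hT : Measurable T) (hf : Measurable f) (n : ℕ) :
    Measurable (birkhoffSum T f n) := by
  have : birkhoffSum T f n = fun x => ∑ k ∈ Finset.range n, f (T^[k] x) := rfl
  rw [this]
  exact Finset.measurable_fun_sum _ fun k _ => hf.comp (hT.iterate k)

theorem measurableSet_birkhoffLimsupSet (hT : Measurable T) (hf : Measurable f) (v : ℤ) :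
    MeasurableSet (birkhoffLimsupSet T f v) := by
  have h := measurable_birkhoffSum_int hT hf
  simp only [birkhoffLimsupSet, frequently_atTop, eventually_atTop, Set.ofPred_and,
    Set.ofPred_forall, Set.ofPred_exists]
  refine .inter (.iInter fun a => .iUnion fun b => .inter (.const _) ?_)
    (.iUnion fun a => .iInter fun b => .iInter fun _ => ?_)
  · exact h b (measurableSet_singleton v)
  · exact h b (measurableSet_Iic (a := v))

/-- If `T ∘ T` is ergodic, the Birkhoff sums of an odd-valued function are unbounded: otherwise
the parity of their upper limit would be invariant under `T ∘ T`, but not under `T`. -/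
theorem not_ae_bounded_birkhoffSum_of_odd {μ : Measure α} [NeZero μ]
    (hT : MeasurePreserving T μ μ) (hT₂ : Ergodic (T ∘ T) μ) (hf : Measurable f)
    (hodd : ∀ x, Odd (f x)) (B : ℤ) : ¬ ∀ᵐ x ∂μ, ∀ n, |birkhoffSum T f n x| ≤ B := by
  intro hB
  let A : Set α := ⋃ v : ℤ, birkhoffLimsupSet T f (2 * v)
  let O : Set α := ⋃ v : ℤ, birkhoffLimsupSet T f (2 * v + 1)
  have hA : MeasurableSet A :=
    .iUnion fun v => measurableSet_birkhoffLimsupSet hT.measurable hf _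
  have hTA : T ⁻¹' A = O := by
    ext x
    obtain ⟨k, hk⟩ := hodd x
    simp only [A, O, Set.mem_preimage, Set.mem_iUnion, apply_mem_birkhoffLimsupSet_iff, hk]
    refine ⟨fun ⟨v, hv⟩ => ⟨v + k, ?_⟩, fun ⟨v, hv⟩ => ⟨v - k, ?_⟩⟩ <;> convert hv using 2 <;> ring
  have hTO : T ⁻¹' O = A := by
    ext x
    obtain ⟨k, hk⟩ := hodd x
    simp only [A, O, Set.mem_preimage, Set.mem_iUnion, apply_mem_birkhoffLimsupSet_iff, hk]
    refine ⟨fun ⟨v, hv⟩ => ⟨v + k + 1, ?_⟩, fun ⟨v, hv⟩ => ⟨v - k - 1, ?_⟩⟩ <;>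
      convert hv using 2 <;> ring
  have hOA : O ⊆ Aᶜ := by
    intro x hx hx'
    obtain ⟨v, hv⟩ := Set.mem_iUnion.1 hx
    obtain ⟨w, hw⟩ := Set.mem_iUnion.1 hx'
    have := eq_of_mem_birkhoffLimsupSet hv hw
    lia
  have hcov : μ (A ∪ O)ᶜ = 0 := by
    change A ∪ O ∈ ae μ
    filter_upwards [hB] with x hx
    obtain ⟨v, hv⟩ := exists_frequently_eq_eventually_le hx
    obtain ⟨w, hw | hw⟩ := Int.even_or_odd' v
    · exact .inl (Set.mem_iUnion.2 ⟨w, hw ▸ hv⟩)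
    · exact .inr (Set.mem_iUnion.2 ⟨w, hw ▸ hv⟩)
  have hμ : μ O = μ A := by rw [← hTA, hT.measure_preimage hA.nullMeasurableSet]
  have hzero : μ A = 0 := by
    rcases hT₂.toPreErgodic.measure_self_or_compl_eq_zero hA
      (by rw [Set.preimage_comp, hTA, hTO]) with h | h
    · exact h
    · rw [← hμ]; exact measure_mono_null hOA h
  refine NeZero.ne μ (Measure.measure_univ_eq_zero.1 ?_)
  rw [← Set.union_compl_self (A ∪ O)]
  exact measure_union_null (measure_union_null hzero (hμ.trans hzero)) hcov

end

/-! ### From a dense set of starting points to almost every point -/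

theorem ContinuousAt.birkhoffSum_int {X : Type*} [TopologicalSpace X] {T : X → X} {f : X → ℤ}
    (hT : Continuous T) {x : X} (hf : ∀ i, ContinuousAt f (T^[i] x)) (n : ℕ) :
    ContinuousAt (birkhoffSum T f n) x := by
  have : birkhoffSum T f n = fun x => ∑ k ∈ Finset.range n, f (T^[k] x) := rfl
  rw [this]
  exact tendsto_finsetSum _ fun k _ => (hf k).comp (hT.iterate k).continuousAt

/-- An integer-valued function continuous at `x` is constant near `x`, so the sum at `x` equals the
sum at some nearby `s j`. -/
theorem DenseRange.abs_birkhoffSum_le {X ι : Type*} [TopologicalSpace X] {T : X → X} {f : X → ℤ}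
    {s : ι → X} (hs : DenseRange s) {B : ℤ} (hB : ∀ j n, |birkhoffSum T f n (s j)| ≤ B)
    (hT : Continuous T) {x : X} (hf : ∀ i, ContinuousAt f (T^[i] x)) (n : ℕ) :
    |birkhoffSum T f n x| ≤ B := by
  obtain ⟨U, hU, hUo, hx⟩ := mem_nhds_iff.1 ((ContinuousAt.birkhoffSum_int hT hf n).preimage_mem_nhds
    ((isOpen_discrete {birkhoffSum T f n x}).mem_nhds rfl))
  obtain ⟨j, hj⟩ := hs.exists_mem_open hUo ⟨x, hx⟩
  have : birkhoffSum T f n (s j) = birkhoffSum T f n x := hU hj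
  rw [← this]
  exact hB j n

/-! ### The rotation by 1 on the circle of length φ -/

instance fact_goldenRatio_pos : Fact (0 < φ) := ⟨goldenRatio_pos⟩

theorem ergodic_add_one_comp_add_one :
    Ergodic ((· + ((1 : ℝ) : AddCircle φ)) ∘ (· + ((1 : ℝ) : AddCircle φ))) := by
  have e : (· + ((1 : ℝ) : AddCircle φ)) ∘ (· + ((1 : ℝ) : AddCircle φ)) =
      (· + ((2 : ℝ) : AddCircle φ)) := by
    funext y
    rw [comp_apply, add_assoc, ← AddCircle.coe_add, one_add_one_eq_two]
  rw [e, AddCircle.ergodic_add_right, ← AddCircle.denseRange_zsmul_iff,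
    AddCircle.denseRange_zsmul_coe_iff]
  exact_mod_cast goldenRatio_irrational.natCast_div two_ne_zero

/-- The function on the circle of length `φ` that is `1` on the left half of the Fibonacci window
and `-1` on its right half. -/
noncomputable def halfSign (y : AddCircle φ) : ℤ :=
  if (AddCircle.equivIco φ (-(1 / φ)) y : ℝ) < (1 - 1 / φ) / 2 then 1 else -1

theorem odd_halfSign (y : AddCircle φ) : Odd (halfSign y) := by
  unfold halfSign; split_ifs <;> decide

theorem measurable_halfSign : Measurable halfSign :=
  Measurable.ite (measurableSet_lt
    (measurable_subtype_coe.comp (AddCircle.measurableEquivIco φ (-(1 / φ))).measurable)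
    measurable_const) measurable_const measurable_const

/-- Away from the seam of the chart and the midpoint of the window, the strict inequality that
decides the sign persists nearby. -/
theorem continuousAt_halfSign {y : AddCircle φ} (h₁ : y ≠ ((-(1 / φ) : ℝ) : AddCircle φ))
    (h₂ : y ≠ (((1 - 1 / φ) / 2 : ℝ) : AddCircle φ)) : ContinuousAt halfSign y := by
  have hc : ContinuousAt (fun z => (AddCircle.equivIco φ (-(1 / φ)) z : ℝ)) y :=
    continuous_subtype_val.continuousAt.comp (AddCircle.continuousAt_equivIco φ _ h₁)
  have hne : (AddCircle.equivIco φ (-(1 / φ)) y : ℝ) ≠ (1 - 1 / φ) / 2 := fun h =>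
    h₂ (by rw [← h, AddCircle.coe_equivIco])
  refine continuousAt_const.congr (f := fun _ => halfSign y) ?_
  rcases hne.lt_or_gt with h | h
  · filter_upwards [hc.eventually_lt continuousAt_const h] with z hz
    simp only [halfSign, if_pos h, if_pos hz]
  · filter_upwards [continuousAt_const.eventually_lt hc h] with z hz
    simp only [halfSign, if_neg h.not_gt, if_neg hz.not_gt]

theorem denseRange_intCast_addCircle :
    DenseRange fun j : ℤ => ((j : ℝ) : AddCircle φ) := by
  have h : DenseRange (· • (1 : ℝ) : ℤ → AddCircle φ) :=
    AddCircle.denseRange_zsmul_coe_iff.2 (by simpa using goldenRatio_irrational.inv)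
  refine h.mono ?_
  rintro _ ⟨j, rfl⟩
  exact ⟨j, by simp [← AddCircle.coe_zsmul]⟩

theorem MeasureTheory.MeasurePreserving.ae_iterate_ne {α : Type*} [MeasurableSpace α]
    {μ : Measure α} {T : α → α} (hT : MeasurePreserving T μ μ) {a : α} (h : ∀ᵐ x ∂μ, x ≠ a)
    (i : ℕ) : ∀ᵐ x ∂μ, T^[i] x ≠ a :=
  (hT.iterate i).quasiMeasurePreserving.ae h

theorem ae_iterate_add_ne {p : ℝ} [hp : Fact (0 < p)] (r a : AddCircle p) :
    ∀ᵐ y : AddCircle p, ∀ i : ℕ, (· + r)^[i] y ≠ a := by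
  have ha : volume ({a} : Set (AddCircle p)) = 0 := by
    rw [← Metric.closedBall_zero, AddCircle.volume_closedBall, mul_zero, min_eq_right hp.out.le,
      ENNReal.ofReal_zero]
  have hne : ∀ᵐ y : AddCircle p, y ≠ a := measure_eq_zero_iff_ae_notMem.1 ha
  exact ae_all_iff.2 ((measurePreserving_add_right volume r).ae_iterate_ne hne)

theorem not_bounded_birkhoffSum_halfSign (B : ℤ) :
    ¬ ∀ (j : ℤ) (n : ℕ),
      |birkhoffSum (· + ((1 : ℝ) : AddCircle φ)) halfSign n ((j : ℝ) : AddCircle φ)| ≤ B := by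
  intro hB
  have hT : MeasurePreserving (· + ((1 : ℝ) : AddCircle φ)) volume volume :=
    measurePreserving_add_right _ _
  refine not_ae_bounded_birkhoffSum_of_odd hT ergodic_add_one_comp_add_one measurable_halfSign
    odd_halfSign B ?_
  filter_upwards [ae_iterate_add_ne _ ((-(1 / φ) : ℝ) : AddCircle φ),
    ae_iterate_add_ne _ (((1 - 1 / φ) / 2 : ℝ) : AddCircle φ)]
    with y h₁ h₂ n
  exact denseRange_intCast_addCircle.abs_birkhoffSum_le hB (continuous_add_const _)
    (fun i => continuousAt_halfSign (h₁ i) (h₂ i)) n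

/-! ### Index counts and bounded distance equivalence -/

/-- The images under `σ` stay in the interval enlarged by `c` at both ends, and each added end has
`c` integers. -/
theorem card_filter_Ico_add_le {A B : Set ℤ} [DecidablePred (· ∈ A)] [DecidablePred (· ∈ B)]
    {c : ℤ} (σ : A → B) (hσ : Injective σ) (hc : ∀ k : A, |(k : ℤ) - σ k| ≤ c) (hc0 : 0 ≤ c)
    (a b : ℤ) :
    (((Finset.Ico a b).filter (· ∈ A)).card : ℤ) ≤
      ((Finset.Ico a b).filter (· ∈ B)).card + 2 * c := by
  have h1 : ((Finset.Ico a b).filter (· ∈ A)).card ≤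
      ((Finset.Ico (a - c) (b + c)).filter (· ∈ B)).card := by
    -- The value `0` is a filler; only `k ∈ A` are counted.
    refine Finset.card_le_card_of_injOn (fun k => if h : k ∈ A then (σ ⟨k, h⟩ : ℤ) else 0) ?_ ?_
    · intro k hk
      obtain ⟨hk, hkA⟩ := Finset.mem_filter.1 hk
      have h := abs_le.1 (hc ⟨k, hkA⟩)
      have hB := (σ ⟨k, hkA⟩).2
      simp only [Finset.mem_Ico, Finset.coe_filter, Set.mem_ofPred_eq, hkA, dif_pos] at hk h ⊢
      exact ⟨by lia, hB⟩
    · intro k hk l hl hkl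
      have hkA := (Finset.mem_filter.1 hk).2
      have hlA := (Finset.mem_filter.1 hl).2
      simp only [hkA, hlA, dif_pos] at hkl
      exact congrArg Subtype.val (hσ (Subtype.ext hkl))
  have h2 : (Finset.Ico (a - c) (b + c)).filter (· ∈ B) ⊆
      (Finset.Ico a b).filter (· ∈ B) ∪ (Finset.Ico (a - c) a ∪ Finset.Ico b (b + c)) := by
    intro k
    simp only [Finset.mem_filter, Finset.mem_union, Finset.mem_Ico]
    rintro ⟨h, hB⟩
    by_cases h1 : a ≤ k <;> by_cases h2 : k < b <;> simp [hB] <;> lia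
  have h3 := (Finset.card_le_card h2).trans ((Finset.card_union_le _ _).trans
    (Nat.add_le_add_left (Finset.card_union_le _ _) _))
  simp only [Int.card_Ico] at h3
  lia

/-- The multiple of `φ` that takes the integer `k` into the Fibonacci window. -/
noncomputable def fibDiv (k : ℤ) : ℤ := toIcoDiv goldenRatio_pos (-(1 / φ)) (k : ℝ)

/-- The `k`-th point of the Fibonacci sequence. -/
noncomputable def fibPoint (k : ℤ) : ℝ := k + fibDiv k * (φ - 1)

theorem fibDiv_mono : Monotone fibDiv := by
  intro j k hjk
  have hj := sub_toIcoDiv_zsmul_mem_Ico goldenRatio_pos (-(1 / φ)) (j : ℝ)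
  have hk := sub_toIcoDiv_zsmul_mem_Ico goldenRatio_pos (-(1 / φ)) (k : ℝ)
  change (j : ℝ) - fibDiv j • φ ∈ _ at hj
  change (k : ℝ) - fibDiv k • φ ∈ _ at hk
  simp only [zsmul_eq_mul, Set.mem_Ico] at hj hk
  have hjk' : (j : ℝ) ≤ k := by exact_mod_cast hjk
  by_contra! hlt
  have : (fibDiv k : ℝ) + 1 ≤ fibDiv j := by exact_mod_cast hlt
  nlinarith [goldenRatio_pos]

/-- The correction `fibDiv k * (φ - 1)` is nondecreasing in `k`, since `fibDiv` is monotone and `φ >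
1`. -/
theorem le_fibPoint_sub {j k : ℤ} (h : j ≤ k) : ((k - j : ℤ) : ℝ) ≤ fibPoint k - fibPoint j := by
  have h1 : (fibDiv j : ℝ) ≤ fibDiv k := by exact_mod_cast fibDiv_mono h
  unfold fibPoint
  push_cast
  nlinarith [one_lt_goldenRatio]

theorem abs_sub_le_dist_fibPoint (j k : ℤ) :
    ((|j - k| : ℤ) : ℝ) ≤ dist (fibPoint j) (fibPoint k) := by
  wlog h : j ≤ k generalizing j k
  · rw [abs_sub_comm, dist_comm]; exact this k j (le_of_not_ge h)
  rw [abs_sub_comm, dist_comm, abs_of_nonneg (sub_nonneg.2 h), Real.dist_eq]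
  exact (le_fibPoint_sub h).trans (le_abs_self _)

theorem fibPoint_injective : Injective fibPoint := by
  intro j k h
  have := abs_sub_le_dist_fibPoint j k
  rw [h, dist_self] at this
  have h' : |j - k| ≤ 0 := by exact_mod_cast this
  exact sub_eq_zero.1 (abs_nonpos_iff.1 h')

/-- For a lattice point with coefficients `m`, `n`, the internal coordinate is `(m + n) - nφ`. The
full window has length `φ`, so lying in it forces `n = fibDiv (m + n)`. -/
theorem cutAndProject_eq_image_fibPoint {W : Set ℝ} (hW : W ⊆ fibWindow) :
    cutAndProject fibLattice W = fibPoint '' {k | (k : ℝ) - fibDiv k * φ ∈ W} := by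
  ext p
  constructor
  · rintro ⟨x, hx, hxW, rfl⟩
    obtain ⟨m, n, h1, h2⟩ := mem_fibLattice.1 hx
    have hn : fibDiv (m + n) = n := by
      refine toIcoDiv_eq_of_sub_zsmul_mem_Ico goldenRatio_pos ?_
      have := hW hxW
      rw [fibWindow, one_div_goldenRatio, Set.mem_Ico] at this
      rw [one_div_goldenRatio, Set.mem_Ico, zsmul_eq_mul]
      push_cast
      constructor <;> linarith
    refine ⟨m + n, ?_, ?_⟩
    · simp only [Set.mem_ofPred_eq, hn]
      convert hxW using 1
      rw [h2]; push_cast; ring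
    · rw [fibPoint, hn, h1]; push_cast; ring
  · rintro ⟨k, hk, rfl⟩
    refine ⟨(fibPoint k, k - fibDiv k * φ), mem_fibLattice.2 ⟨k - fibDiv k, fibDiv k, ?_, ?_⟩,
      hk, rfl⟩
    · simp only [fibPoint]; push_cast; ring
    · push_cast; ring

/-- A bijection between images under `fibPoint` that moves points boundedly induces an injection
between the sets of indices that does so too. -/
theorem exists_injective_index_map {A B : Set ℤ} {c : ℝ} (f : fibPoint '' A ≃ fibPoint '' B)
    (hf : ∀ x : fibPoint '' A, dist (x : ℝ) (f x) < c) :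
    ∃ σ : A → B, Injective σ ∧ ∀ k : A, |(k : ℤ) - σ k| ≤ ⌈c⌉ := by
  choose! g hgB hg using fun k : A => (f ⟨fibPoint k, Set.mem_image_of_mem _ k.2⟩).2
  refine ⟨fun k => ⟨g k, hgB k⟩, fun k l hkl => ?_, fun k => ?_⟩
  · have : g k = g l := congrArg Subtype.val hkl
    have h := (hg k).symm.trans ((congrArg fibPoint this).trans (hg l))
    exact Subtype.ext (fibPoint_injective (congrArg Subtype.val (f.injective (Subtype.ext h))))
  · have h1 := abs_sub_le_dist_fibPoint k (g k)
    rw [hg k] at h1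
    have h2 := hf ⟨fibPoint k, Set.mem_image_of_mem _ k.2⟩
    exact_mod_cast (h1.trans h2.le).trans (Int.le_ceil c)

theorem equivIco_intCast (k : ℤ) :
    (AddCircle.equivIco φ (-(1 / φ)) ((k : ℝ) : AddCircle φ) : ℝ) = k - fibDiv k * φ := by
  have : (AddCircle.equivIco φ (-(1 / φ)) ((k : ℝ) : AddCircle φ) : ℝ) =
    (k : ℝ) - fibDiv k • φ := rfl
  rw [this, zsmul_eq_mul]

theorem birkhoffSum_halfSign_intCast (j : ℤ) (n : ℕ) :
    birkhoffSum (· + ((1 : ℝ) : AddCircle φ)) halfSign n ((j : ℝ) : AddCircle φ) =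
      ∑ k ∈ Finset.Ico j (j + n), halfSign ((k : ℝ) : AddCircle φ) := by
  have hit : ∀ i : ℕ, (· + ((1 : ℝ) : AddCircle φ))^[i] ((j : ℝ) : AddCircle φ) =
      (((j + i : ℤ) : ℝ) : AddCircle φ) := by
    intro i
    induction i with
    | zero => simp
    | succ i ih => rw [iterate_succ_apply', ih, ← AddCircle.coe_add]; push_cast; rw [add_assoc]
  simp only [birkhoffSum, hit]
  refine Finset.sum_nbij' (fun i => j + i) (fun k => (k - j).toNat) ?_ ?_ ?_ ?_ ?_ <;>
    simp only [Finset.mem_range, Finset.mem_Ico] <;> intros <;> first | rfl | lia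

theorem not_boundedDistEquiv_halfFib : ¬ BoundedDistEquiv halfFib₁ halfFib₂ := by
  classical
  rintro ⟨c, hc, hf⟩
  rw [halfFib₁, halfFib₂,
    cutAndProject_eq_image_fibPoint (halfFibWindow_union ▸ Set.subset_union_left),
    cutAndProject_eq_image_fibPoint (halfFibWindow_union ▸ Set.subset_union_right)] at hf
  obtain ⟨f, hf⟩ := hf
  obtain ⟨σ, hσ, hσc⟩ := exists_injective_index_map f hf
  obtain ⟨σ', hσ', hσc'⟩ := exists_injective_index_map f.symm (c := c) (fun x => by
    rw [dist_comm]; simpa using hf (f.symm x))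
  have hc0 : 0 ≤ ⌈c⌉ := Int.ceil_nonneg hc.le
  refine not_bounded_birkhoffSum_halfSign (2 * ⌈c⌉) fun j n => ?_
  have h1 := card_filter_Ico_add_le σ hσ hσc hc0 j (j + n)
  have h2 := card_filter_Ico_add_le σ' hσ' hσc' hc0 j (j + n)
  -- Every integer has its representative in the full window, so exactly one of the two indicators
  -- is `1`, and the Birkhoff sum becomes a difference of index counts.
  have hs : ∀ k : ℤ, halfSign ((k : ℝ) : AddCircle φ) =
      (if k ∈ {k : ℤ | (k : ℝ) - fibDiv k * φ ∈ halfFibWindow₁} then 1 else 0) -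
      (if k ∈ {k : ℤ | (k : ℝ) - fibDiv k * φ ∈ halfFibWindow₂} then 1 else 0) := by
    intro k
    have hk := (AddCircle.equivIco φ (-(1 / φ)) ((k : ℝ) : AddCircle φ)).2
    rw [equivIco_intCast, Set.mem_Ico, one_div_goldenRatio] at hk
    have hk2 : (k : ℝ) - fibDiv k * φ < 1 := by linarith [hk.2]
    rw [← one_div_goldenRatio] at hk
    simp only [halfSign, equivIco_intCast, Set.mem_ofPred_eq, halfFibWindow₁, halfFibWindow₂,
      Set.mem_Ico, hk.1, hk2, true_and, and_true]
    rcases lt_or_ge ((k : ℝ) - fibDiv k * φ) ((1 - 1 / φ) / 2) with h | h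
    · simp only [h, h.not_ge, if_true, if_false]; rfl
    · simp only [h, h.not_gt, if_true, if_false]; rfl
  rw [birkhoffSum_halfSign_intCast, Finset.sum_congr rfl fun k _ => hs k,
    Finset.sum_sub_distrib, Finset.sum_boole, Finset.sum_boole, abs_le]
  constructor <;> linarith

theorem theorem6p4 :
    IsCutAndProjectData fibLattice halfFibWindow₁ ∧
    IsCutAndProjectData fibLattice halfFibWindow₂ ∧
    Disjoint halfFibWindow₁ halfFibWindow₂ ∧
    halfFibWindow₁ ∪ halfFibWindow₂ = fibWindow ∧
    MeasureTheory.volume halfFibWindow₁ = MeasureTheory.volume halfFibWindow₂ ∧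
    hull halfFib₁ = hull halfFib₂ ∧
    ¬ BoundedDistEquiv halfFib₁ halfFib₂ :=
  ⟨isCutAndProjectData_fibLattice (Metric.isBounded_Ico _ _),
    isCutAndProjectData_fibLattice (Metric.isBounded_Ico _ _), disjoint_halfFibWindow,
    halfFibWindow_union, volume_halfFibWindow, hull_halfFib_eq, not_boundedDistEquiv_halfFib⟩
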